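/- Let $r>0$, let $X=\mathbb{P}^1(\mathbb{C})$ with homogeneous coordinates $[x_0:x_1]$, and let $L=\mathcal{O}(1)$ be endowed with the capacity metric of the disc of radius $r$, $$|s([x_0:x_1])|_L=\frac{|s(x_0,x_1)|}{\max(|x_0|,r^{-1}|x_1|)} ,$$ and $L^{\otimes n}$ with the induced tensor power metric. For a section $s\in H^0(X,L^{\otimes n})=\mathbb{C}[X_0,X_1]_n$ put $\|s\|_{L^{\otimes n}}=\sup_{p\in X}|s(p)|_{L^{\otimes n}}$. Let $x=[1:\zeta]$ with $|\zeta|=r$ be a point of the boundary circle of the disc (for example $\zeta=r$), with local parameter $t=\frac{X_1-\zeta X_0}{X_0}$ at $x$ and local trivialization $\sigma=X_0$ of $L$. If $s\neq 0$ has the expansion $s=\bigl(\sum_{k\ge 0}a_kt^k\bigr)\sigma^{\otimes n}$ at $x$, let $\mathrm{ord}_x(s)=\min\{k: a_k\ne 0\}$ and $\mathrm{lead}_x(s)=a_{\mathrm{ord}_x(s)}$. For $a\in \mathrm{ord}_x(H^0(X,L^{\otimes n})\setminus\{0\})$ let $$F_n(a)=\sup_{\substack{0\ne s\in H^0(X,L^{\otimes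 n})\\ \mathrm{ord}_x(s)=a}}\frac{|\mathrm{lead}_x(s)|}{\|s\|_{L^{\otimes n}}} .$$ Then the Okounkov body $\overline{\bigcup_{n\ge1}\frac1n\,\mathrm{ord}_x(H^0(X,L^{\otimes n})\setminus\{0\})}$ equals $[0,1]$, and for every $\alpha\in[0,1]$ the local Chebyshev transform $$c(\alpha)=\lim_{n\to\infty}\frac1n\log F_n(a_n)$$ is well defined: there are sequences $(a_n)_{n\ge 1}$ with $a_n\in\mathrm{ord}_x(H^0(X,L^{\otimes n})\setminus\{0\})$ and $\frac1n a_n\to\alpha$, and along every such sequence the limit exists and has the same value, namely $$c(\alpha)=-\alpha\log(4r)+\tfrac12(1+\alpha)\log(1+\alpha)-\tfrac12(1-\alpha)\log(1-\alpha)-\alpha\log\alpha ,$$ with the convention $0\log 0=0$. -/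

import Mathlib

/-!
Complex projective line with homogeneous coordinates `X₀ = X 0`, `X₁ = X 1`.  Global sections of
`𝒪(n)` are the homogeneous polynomials of degree `n` in `ℂ[X₀, X₁]`, that is, the elements of
`MvPolynomial.homogeneousSubmodule (Fin 2) ℂ n`.
-/

open Filter Topology

noncomputable section

namespace DiscChebyshev

/-- Points of the complex projective line. -/
abbrev P1 : Type := Projectivization ℂ (Fin 2 → ℂ)

/-- Pointwise norm `|s(x)|` of a section `s` of `𝒪(n)`, for the `n`-th tensor power of the
capacity metric of the disc of radius `r` on `𝒪(1)`:
`|s([x₀ : x₁])| = |s(x₀, x₁)| / max (|x₀|, r⁻¹ |x₁|) ^ n`.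
It does not depend on the homogeneous coordinates, see `pointNorm_mk`. -/
def pointNorm (r : ℝ) (n : ℕ) (s : MvPolynomial (Fin 2) ℂ) (p : P1) : ℝ :=
  ‖MvPolynomial.eval p.rep s‖ / max ‖p.rep 0‖ (r⁻¹ * ‖p.rep 1‖) ^ n

/-- Supremum norm of a section of `𝒪(n)` over the projective line. -/
def supNorm (r : ℝ) (n : ℕ) (s : MvPolynomial (Fin 2) ℂ) : ℝ :=
  ⨆ p : P1, pointNorm r n s p

/-- Taylor expansion at the point `[1 : ζ]` of a section `s` of `𝒪(n)`, with respect to the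
local parameter `t = (X₁ - ζ X₀) / X₀` and to the local trivialization `σ = X₀`:
`s = (germ ζ s)(t) · σ ^ n`, see `eval_eq_germ`.  For these choices the expansion
`s(1, ζ + t)` is a polynomial in `t`. -/
def germ (ζ : ℂ) (s : MvPolynomial (Fin 2) ℂ) : Polynomial ℂ :=
  MvPolynomial.aeval ![1, Polynomial.C ζ + Polynomial.X] s

/-- Order of vanishing at `[1 : ζ]` of a nonzero section. -/
def ordAt (ζ : ℂ) (s : MvPolynomial (Fin 2) ℂ) : ℕ :=
  (germ ζ s).natTrailingDegree

/-- Leading coefficient at `[1 : ζ]` of a nonzero section. -/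
def lead (ζ : ℂ) (s : MvPolynomial (Fin 2) ℂ) : ℂ :=
  (germ ζ s).trailingCoeff

/-- The set of orders of vanishing at `[1 : ζ]` of the nonzero global sections of `𝒪(n)`. -/
def ordSet (ζ : ℂ) (n : ℕ) : Set ℕ :=
  {a | ∃ s ∈ MvPolynomial.homogeneousSubmodule (Fin 2) ℂ n, s ≠ 0 ∧ ordAt ζ s = a}

/-- The Okounkov body of `𝒪(1)` at `[1 : ζ]`: the closure of the set of all `a / n` with `n ≥ 1`
and `a` the order of vanishing at `[1 : ζ]` of a nonzero section of `𝒪(n)`. -/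
def okounkovBody (ζ : ℂ) : Set ℝ :=
  closure (⋃ n : ℕ, ⋃ _ : 1 ≤ n, (fun a : ℕ => (a : ℝ) / (n : ℝ)) '' ordSet ζ n)

/-- The quotients `|lead s| / ‖s‖`, where `s` runs through the nonzero sections of `𝒪(n)` which
vanish at `[1 : ζ]` to order exactly `a`. -/
def quotients (r : ℝ) (ζ : ℂ) (n a : ℕ) : Set ℝ :=
  {y | ∃ s ∈ MvPolynomial.homogeneousSubmodule (Fin 2) ℂ n,
    s ≠ 0 ∧ ordAt ζ s = a ∧ y = ‖lead ζ s‖ / supNorm r n s}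

/-- `F_n(a)`, the supremum of the quotients `|lead s| / ‖s‖` (finite, see
`bddAbove_quotients`). -/
def chebyshevSup (r : ℝ) (ζ : ℂ) (n a : ℕ) : ℝ :=
  sSup (quotients r ζ n a)

/-- The sequences `(a_n)` along which the local Chebyshev transform at `α` is computed: for
`n ≥ 1`, `a_n` is the order of vanishing of some nonzero section of `𝒪(n)`, and `a_n / n → α`. -/
def Approximates (ζ : ℂ) (α : ℝ) (a : ℕ → ℕ) : Prop :=
  (∀ n, 1 ≤ n → a n ∈ ordSet ζ n) ∧ Tendsto (fun n : ℕ => (a n : ℝ) / (n : ℝ)) atTop (𝓝 α)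

/-- The local Chebyshev transform, at the point `[1 : ζ]`, of the capacity metric of the disc of
radius `r` is defined at `α` and takes the value `c` there: admissible sequences exist, and
`(1/n) log F_n(a_n)` tends to `c` along every one of them. -/
def HasChebyshevTransformAt (r : ℝ) (ζ : ℂ) (α c : ℝ) : Prop :=
  (∃ a, Approximates ζ α a) ∧
    ∀ a, Approximates ζ α a →
      Tendsto (fun n : ℕ => 1 / (n : ℝ) * Real.log (chebyshevSup r ζ n (a n))) atTop (𝓝 c)

/-! ### Well-definedness -/

theorem eval_smul_eq {n : ℕ} {s : MvPolynomial (Fin 2) ℂ}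
    (hs : s ∈ MvPolynomial.homogeneousSubmodule (Fin 2) ℂ n) (c : ℂ) (v : Fin 2 → ℂ) :
    MvPolynomial.eval (c • v) s = c ^ n * MvPolynomial.eval v s := by
  have h : s.IsHomogeneous n := hs
  rw [MvPolynomial.eval_eq', MvPolynomial.eval_eq', Finset.mul_sum]
  refine Finset.sum_congr rfl fun d hd => ?_
  have hd' : d 0 + d 1 = n := by
    have := h (MvPolynomial.mem_support_iff.1 hd)
    rw [Finsupp.weight_apply, Finsupp.sum_fintype _ _ (by simp)] at this
    simpa [Fin.sum_univ_two] using this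
  simp only [Fin.prod_univ_two, Pi.smul_apply, smul_eq_mul, mul_pow]
  rw [← hd', pow_add]
  ring

theorem pointNorm_mk {r : ℝ} {n : ℕ} {s : MvPolynomial (Fin 2) ℂ}
    (hs : s ∈ MvPolynomial.homogeneousSubmodule (Fin 2) ℂ n) (v : Fin 2 → ℂ) (hv : v ≠ 0) :
    pointNorm r n s (Projectivization.mk ℂ v hv) =
      ‖MvPolynomial.eval v s‖ / max ‖v 0‖ (r⁻¹ * ‖v 1‖) ^ n := by
  obtain ⟨c, hc⟩ := Projectivization.exists_smul_eq_mk_rep ℂ v hv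
  have hc0 : 0 < ‖(c : ℂ)‖ := norm_pos_iff.2 c.ne_zero
  have hc' : (Projectivization.mk ℂ v hv).rep = (c : ℂ) • v := hc.symm
  rw [pointNorm, hc', eval_smul_eq hs]
  have hmax : max ‖((c : ℂ) • v) 0‖ (r⁻¹ * ‖((c : ℂ) • v) 1‖) =
      ‖(c : ℂ)‖ * max ‖v 0‖ (r⁻¹ * ‖v 1‖) := by
    rw [mul_max_of_nonneg _ _ hc0.le]
    simp only [Pi.smul_apply, smul_eq_mul, norm_mul]
    congr 1
    ring
  rw [hmax, norm_mul, norm_pow, mul_pow, mul_div_mul_left _ _ (pow_pos hc0 n).ne']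

theorem eval_eq_germ {n : ℕ} {s : MvPolynomial (Fin 2) ℂ}
    (hs : s ∈ MvPolynomial.homogeneousSubmodule (Fin 2) ℂ n) (ζ : ℂ) (v : Fin 2 → ℂ)
    (hv : v 0 ≠ 0) :
    MvPolynomial.eval v s = (germ ζ s).eval ((v 1 - ζ * v 0) / v 0) * v 0 ^ n := by
  have h1 : v = v 0 • ![1, ζ + (v 1 - ζ * v 0) / v 0] := by
    ext i
    fin_cases i
    · simp
    · simp
      field_simp
      ring
  have h2 : ∀ t : ℂ, (germ ζ s).eval t = MvPolynomial.eval ![1, ζ + t] s := by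
    intro t
    rw [germ, ← Polynomial.coe_evalRingHom, MvPolynomial.aeval_def,
      MvPolynomial.hom_eval₂, MvPolynomial.eval_eq', MvPolynomial.eval₂_eq']
    refine Finset.sum_congr rfl fun d _ => ?_
    simp [Fin.prod_univ_two]
  rw [h2, mul_comm, ← eval_smul_eq hs, ← h1]

theorem bddAbove_pointNorm {r : ℝ} (hr : 0 < r) {n : ℕ} {s : MvPolynomial (Fin 2) ℂ}
    (hs : s ∈ MvPolynomial.homogeneousSubmodule (Fin 2) ℂ n) :
    BddAbove (Set.range (pointNorm r n s)) := by
  have h : s.IsHomogeneous n := hs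
  refine ⟨(∑ d ∈ s.support, ‖s.coeff d‖) * max 1 r ^ n, ?_⟩
  rintro _ ⟨p, rfl⟩
  set v := p.rep with hvdef
  set M := max ‖v 0‖ (r⁻¹ * ‖v 1‖) with hM
  have hM0 : 0 ≤ M := (norm_nonneg _).trans (le_max_left _ _)
  have hR : (1 : ℝ) ≤ max 1 r := le_max_left _ _
  have hv0 : ‖v 0‖ ≤ max 1 r * M :=
    (le_max_left _ _ : ‖v 0‖ ≤ M).trans (le_mul_of_one_le_left hM0 hR)
  have hv1 : ‖v 1‖ ≤ max 1 r * M := by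
    have : r⁻¹ * ‖v 1‖ ≤ M := le_max_right _ _
    have h2 : ‖v 1‖ ≤ r * M := by rwa [inv_mul_le_iff₀ hr] at this
    exact h2.trans (mul_le_mul_of_nonneg_right (le_max_right _ _) hM0)
  have key : ‖MvPolynomial.eval v s‖ ≤
      (∑ d ∈ s.support, ‖s.coeff d‖) * (max 1 r * M) ^ n := by
    rw [MvPolynomial.eval_eq', Finset.sum_mul]
    refine (norm_sum_le _ _).trans (Finset.sum_le_sum fun d hd => ?_)
    have hd' : d 0 + d 1 = n := by
      have := h (MvPolynomial.mem_support_iff.1 hd)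
      rw [Finsupp.weight_apply, Finsupp.sum_fintype _ _ (by simp)] at this
      simpa [Fin.sum_univ_two] using this
    rw [norm_mul, Fin.prod_univ_two, norm_mul, norm_pow, norm_pow, ← hd', pow_add]
    gcongr
  show ‖MvPolynomial.eval v s‖ / M ^ n ≤ _
  refine div_le_of_le_mul₀ (pow_nonneg hM0 n) (by positivity) (key.trans (le_of_eq ?_))
  rw [mul_pow]
  ring

theorem norm_coeff_germ_le {r : ℝ} (hr : 0 < r) {n : ℕ} {s : MvPolynomial (Fin 2) ℂ}
    (hs : s ∈ MvPolynomial.homogeneousSubmodule (Fin 2) ℂ n) (ζ : ℂ) (a : ℕ) :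
    ‖(germ ζ s).coeff a‖ ≤ supNorm r n s * max 1 (r⁻¹ * (‖ζ‖ + 1)) ^ n := by
  have hsup0 : 0 ≤ supNorm r n s := Real.iSup_nonneg fun p => by
    unfold pointNorm
    positivity
  have hbound : ∀ t ∈ Metric.sphere (0 : ℂ) 1,
      ‖(germ ζ s).eval t‖ ≤ supNorm r n s * max 1 (r⁻¹ * (‖ζ‖ + 1)) ^ n := by
    intro t ht
    have ht1 : ‖t‖ = 1 := by simpa using ht
    have hv : (![1, ζ + t] : Fin 2 → ℂ) ≠ 0 := fun h0 => by simpa using congrFun h0 0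
    have h1 := eval_eq_germ hs ζ ![1, ζ + t] (by simp)
    have h2 := le_ciSup (bddAbove_pointNorm hr hs) (Projectivization.mk ℂ _ hv)
    rw [pointNorm_mk hs] at h2
    simp only [Matrix.cons_val_zero, Matrix.cons_val_one, mul_one, div_one, one_pow,
      add_sub_cancel_left, norm_one] at h1 h2
    rw [h1, div_le_iff₀ (by positivity)] at h2
    refine h2.trans (mul_le_mul_of_nonneg_left ?_ hsup0)
    gcongr
    exact (norm_add_le _ _).trans (by rw [ht1])
  have hd : DiffContOnCl ℂ (fun t => (germ ζ s).eval t) (Metric.ball 0 1) :=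
    (Polynomial.differentiable _).diffContOnCl
  have h3 := Complex.norm_iteratedDeriv_le_of_forall_mem_sphere_norm_le a one_pos hd hbound
  have h4 : iteratedDeriv a (fun t => (germ ζ s).eval t) 0 = a.factorial * (germ ζ s).coeff a := by
    have h5 : ∀ (k : ℕ) (p : Polynomial ℂ), iteratedDeriv k (fun t => p.eval t) =
        fun t => (Polynomial.derivative^[k] p).eval t := by
      intro k
      induction k with
      | zero => intro p; simp
      | succ k ih =>
        intro p
        have h6 : deriv (fun t => p.eval t) = fun t => (Polynomial.derivative p).eval t := by
          ext t
          exact Polynomial.deriv p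
        rw [iteratedDeriv_succ', h6, ih, Function.iterate_succ_apply]
    rw [h5]
    show Polynomial.eval 0 _ = _
    rw [← Polynomial.coeff_zero_eq_eval_zero, Polynomial.coeff_iterate_derivative]
    simp [Nat.descFactorial_self]
  rw [h4, norm_mul, Complex.norm_natCast, one_pow, div_one] at h3
  exact le_of_mul_le_mul_left h3 (by exact_mod_cast a.factorial_pos)

theorem supNorm_pos {r : ℝ} (hr : 0 < r) {n : ℕ} {s : MvPolynomial (Fin 2) ℂ}
    (hs : s ∈ MvPolynomial.homogeneousSubmodule (Fin 2) ℂ n) (hs0 : s ≠ 0) :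
    0 < supNorm r n s := by
  have hsup0 : 0 ≤ supNorm r n s := Real.iSup_nonneg fun p => by
    unfold pointNorm
    positivity
  refine lt_of_le_of_ne hsup0 fun h0 => hs0 ?_
  have hv : ∀ v : Fin 2 → ℂ, v ≠ 0 → MvPolynomial.eval v s = 0 := by
    intro v hv
    have h2 := le_ciSup (bddAbove_pointNorm hr hs) (Projectivization.mk ℂ v hv)
    rw [show (⨆ p, pointNorm r n s p) = supNorm r n s from rfl, ← h0, pointNorm_mk hs] at h2
    have hM : 0 < max ‖v 0‖ (r⁻¹ * ‖v 1‖) := by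
      by_contra hcon
      rw [not_lt, max_le_iff] at hcon
      refine hv ?_
      have h1 : ‖v 1‖ ≤ 0 := by
        have := hcon.2
        rw [inv_mul_le_iff₀ hr] at this
        simpa using this
      ext i
      fin_cases i
      · simpa using hcon.1
      · simpa using h1
    rw [div_le_iff₀ (pow_pos hM n), zero_mul] at h2
    simpa using h2
  have hpoly : s * MvPolynomial.X 0 = 0 := by
    refine MvPolynomial.funext fun v => ?_
    by_cases h : v = 0
    · simp [h]
    · simp [hv v h]
  exact (mul_eq_zero.1 hpoly).resolve_right (MvPolynomial.X_ne_zero 0)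

theorem bddAbove_quotients {r : ℝ} (hr : 0 < r) (ζ : ℂ) (n a : ℕ) :
    BddAbove (quotients r ζ n a) := by
  refine ⟨max 1 (r⁻¹ * (‖ζ‖ + 1)) ^ n, ?_⟩
  rintro _ ⟨s, hs, hs0, -, rfl⟩
  rw [div_le_iff₀ (supNorm_pos hr hs hs0), mul_comm]
  exact norm_coeff_germ_le hr hs ζ _

end DiscChebyshev

end

namespace DiscChebyshev

/-! Write a section as `∑ b_k X₀^(n-k) X₁^k` and put `u_k = b_k ζ^k`. As `|ζ| = r`, its sup norm
lies between `max |u_k|` (Cauchy's estimate) and `∑ |u_k|`, and `ζ^j` times its `j`-th Taylor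
coefficient at `[1 : ζ]` is the moment `∑ u_k C(k,j)`. Up to factors polynomial in `n`, `r^a F_n(a)`
is thus the largest `a`-th moment of a unit vector on `{0, …, n}` orthogonal to all polynomials of
degree `< a`.

The extremal vector in `ℓ²` is the discrete Chebyshev (Gram) polynomial `φ` of degree `a`. Used as a
section it bounds `F_n(a)` from below; used as a test function it bounds it from above
(`norm_lead_le`). A discrete Rodrigues formula gives its leading binomial coefficient `C(2a,a)` and
its `a`-th moment `C(n+a+1,2a+1)` (`exists_discreteChebyshev`). Hence `r^a F_n(a)` equals
`√(C(n+a+1,2a+1) / C(2a,a))` up to a factor `√(n+1)` either way (`abs_log_chebyshevSup_sub_le`), and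
Stirling's formula yields the limit. -/

/-! ### Binomial sums. -/

/-- The factor `x ^ j` turns `x ^ (k - j)` into `x ^ k`; the terms with `k < j` vanish with the
binomial coefficient. -/
theorem coeff_taylor_eq_sum {R : Type*} [CommRing R] {p : Polynomial R} {n : ℕ}
    (hp : p.natDegree ≤ n) (x : R) (j : ℕ) :
    x ^ j * (Polynomial.taylor x p).coeff j =
      ∑ k ∈ Finset.range (n + 1), p.coeff k * x ^ k * (k.choose j : R) := by
  rw [Polynomial.taylor_coeff, Polynomial.hasseDeriv_apply,
    Polynomial.sum_over_range' _ (by simp) (n + 1) (by omega), Polynomial.eval_finsetSum,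
    Finset.mul_sum]
  refine Finset.sum_congr rfl fun k _ => ?_
  rw [Polynomial.eval_monomial]
  rcases lt_or_ge k j with hkj | hkj
  · simp [Nat.choose_eq_zero_of_lt hkj]
  · rw [← Nat.add_sub_cancel' hkj, Nat.add_sub_cancel_left, pow_add]
    ring

/-- Coefficient of `X^m` in `(1-X)^(-(a+1)) · (1-X)^(-(a+1)) = (1-X)^(-(2a+2))`. -/
theorem sum_choose_mul_choose (a m : ℕ) :
    ∑ l ∈ Finset.range (m + 1), (l + a).choose a * (m - l + a).choose a =
      (m + 2 * a + 1).choose (2 * a + 1) := by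
  have h := congrArg (PowerSeries.coeff m)
    (congrArg Units.val (PowerSeries.invOneSubPow_add ℤ (a + 1) (a + 1)))
  rw [Units.val_mul, show a + 1 + (a + 1) = (2 * a + 1) + 1 by ring,
    PowerSeries.invOneSubPow_val_succ_eq_mk_add_choose,
    PowerSeries.invOneSubPow_val_succ_eq_mk_add_choose, PowerSeries.coeff_mk,
    PowerSeries.coeff_mul, Finset.Nat.sum_antidiagonal_eq_sum_range_succ_mk] at h
  simp only [PowerSeries.coeff_mk] at h
  rw [show m + 2 * a + 1 = 2 * a + 1 + m by ring]
  zify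
  rw [h]
  exact Finset.sum_congr rfl fun l _ => by rw [add_comm l, add_comm (m - l)]

/-! ### Discrete Chebyshev polynomials by a Rodrigues formula. -/

section DiscreteChebyshev

open Polynomial Finset

theorem natDegree_C_sub_X {R : Type*} [CommRing R] [Nontrivial R] (x : R) :
    (C x - X).natDegree = 1 := by
  rw [natDegree_sub, natDegree_X_sub_C]

theorem leadingCoeff_C_sub_X {R : Type*} [CommRing R] [Nontrivial R] (x : R) :
    (C x - X).leadingCoeff = -1 := by
  rw [← neg_sub, leadingCoeff_neg, leadingCoeff_X_sub_C]

/-- The polynomial `C(x,a) C(n+a-x,a)`, with zeros at `0, …, a-1` and `n+1, …, n+a`. Its `a`-th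
difference is the Gram polynomial up to sign. -/
noncomputable def gramKernel (n a : ℕ) : ℝ[X] :=
  C (((a.factorial : ℝ) ^ 2)⁻¹) *
    (descPochhammer ℝ a * (descPochhammer ℝ a).comp (C ((n + a : ℕ) : ℝ) - X))

theorem natDegree_gramKernel (n a : ℕ) : (gramKernel n a).natDegree = 2 * a := by
  have h1 := natDegree_C_sub_X ((n + a : ℕ) : ℝ)
  have h2 : (descPochhammer ℝ a).comp (C ((n + a : ℕ) : ℝ) - X) ≠ 0 := by
    rw [Ne, ← leadingCoeff_eq_zero, leadingCoeff_comp (by rw [h1]; simp),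
      (monic_descPochhammer ℝ a).leadingCoeff, one_mul]
    exact pow_ne_zero _ (by rw [leadingCoeff_C_sub_X]; simp)
  rw [gramKernel, natDegree_C_mul (by positivity),
    natDegree_mul (monic_descPochhammer ℝ a).ne_zero h2, natDegree_comp, h1,
    descPochhammer_natDegree]
  ring

theorem leadingCoeff_gramKernel (n a : ℕ) :
    (gramKernel n a).leadingCoeff = ((a.factorial : ℝ) ^ 2)⁻¹ * (-1) ^ a := by
  have h1 := natDegree_C_sub_X ((n + a : ℕ) : ℝ)
  have h2 := leadingCoeff_C_sub_X ((n + a : ℕ) : ℝ)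
  rw [gramKernel, leadingCoeff_mul, leadingCoeff_mul, leadingCoeff_comp (by rw [h1]; simp),
      (monic_descPochhammer ℝ a).leadingCoeff, h2, descPochhammer_natDegree, leadingCoeff_C]
  ring

theorem eval_gramKernel {n a m : ℕ} (h : m ≤ n + a) :
    (gramKernel n a).eval (m : ℝ) = m.choose a * (n + a - m).choose a := by
  rw [gramKernel, eval_mul, eval_mul, eval_comp, eval_C, eval_sub, eval_C, eval_X, ← Nat.cast_sub h,
    descPochhammer_eval_eq_descFactorial, descPochhammer_eval_eq_descFactorial,
    Nat.descFactorial_eq_factorial_mul_choose, Nat.descFactorial_eq_factorial_mul_choose]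
  push_cast
  have := a.factorial_pos
  field_simp

/-- Generating polynomial of the values of the Gram polynomial. The factor `(1 - X)^a` plays two
roles: on coefficients it is an `a`-th difference, and its zero at `1` is orthogonality to degrees
`< a`. -/
noncomputable def gramPoly (n a : ℕ) : ℝ[X] :=
  (1 - X) ^ a * ∑ l ∈ range (n - a + 1), C (((l + a).choose a * (n - l).choose a : ℕ) : ℝ) * X ^ l

theorem coeff_gramPoly {n a k : ℕ} (h : a ≤ n) (hk : k ≤ n) :
    (gramPoly n a).coeff k = (fwdDiff (1 : ℝ))^[a] (gramKernel n a).eval (k : ℝ) := by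
  rw [fwdDiff_iter_eq_sum_shift, gramPoly, sub_eq_add_neg, add_pow, sum_mul, finsetSum_coeff]
  refine sum_congr rfl fun i hi => ?_
  rw [mem_range] at hi
  have e1 : (1 : ℝ[X]) ^ i * (-X) ^ (a - i) * (a.choose i : ℝ[X]) *
      (∑ l ∈ range (n - a + 1), C (((l + a).choose a * (n - l).choose a : ℕ) : ℝ) * X ^ l) =
      C ((-1) ^ (a - i) * (a.choose i : ℝ)) *
        ((∑ l ∈ range (n - a + 1), C (((l + a).choose a * (n - l).choose a : ℕ) : ℝ) * X ^ l) *
          X ^ (a - i)) := by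
    rw [neg_pow, C_mul, C_pow, C_neg, C_1, ← C_eq_natCast]
    ring
  rw [e1, coeff_C_mul, coeff_mul_X_pow', nsmul_one, ← Nat.cast_add,
    eval_gramKernel (by omega), zsmul_eq_mul]
  push_cast
  congr 1
  -- Indices outside the range of the sum correspond to zeros of the kernel at `k + i`, so no
  -- boundary terms appear.
  split_ifs with hki
  · simp only [finsetSum_coeff, coeff_C_mul, coeff_X_pow, mul_ite, mul_one, mul_zero,
      sum_ite_eq, mem_range, ← Nat.cast_mul]
    split_ifs with hl
    · rw [show k - (a - i) + a = k + i by omega, show n - (k - (a - i)) = n + a - (k + i) by omega]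
      try push_cast
      try ring
    · rw [Nat.choose_eq_zero_of_lt (show n + a - (k + i) < a by omega)]
      simp
  · rw [Nat.choose_eq_zero_of_lt (show k + i < a by omega)]
    simp

theorem natDegree_gramPoly_le {n a : ℕ} (h : a ≤ n) : (gramPoly n a).natDegree ≤ n := by
  refine natDegree_mul_le.trans ?_
  have h1 : ((1 - X : ℝ[X]) ^ a).natDegree ≤ a := by
    refine natDegree_pow_le.trans ?_
    have : (1 - X : ℝ[X]).natDegree ≤ 1 := (natDegree_sub_le _ _).trans (by simp)
    nlinarith
  have h2 := natDegree_sum_le_of_forall_le (range (n - a + 1)) (n := n - a)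
    (fun l => C (((l + a).choose a * (n - l).choose a : ℕ) : ℝ) * X ^ l)
    (fun l hl => (natDegree_C_mul_X_pow_le _ _).trans (by rw [mem_range] at hl; omega))
  omega

theorem taylor_gramPoly (n a : ℕ) : taylor 1 (gramPoly n a) =
    taylor 1 (∑ l ∈ range (n - a + 1), C (((l + a).choose a * (n - l).choose a : ℕ) : ℝ) * X ^ l) *
      C ((-1) ^ a) * X ^ a := by
  rw [gramPoly, taylor_mul, taylor_pow, map_sub, taylor_X, taylor_one, C_1]
  rw [show (1 - (X + 1) : ℝ[X]) = C (-1) * X by simp, mul_pow, C_pow]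
  ring

theorem sum_coeff_gramPoly_mul_choose {n a : ℕ} (h : a ≤ n) (j : ℕ) :
    ∑ k ∈ range (n + 1), (gramPoly n a).coeff k * (k.choose j : ℝ) =
      (taylor 1 (gramPoly n a)).coeff j := by
  have := coeff_taylor_eq_sum (natDegree_gramPoly_le h) 1 j
  simpa using this.symm

/-- Once `(1 - X)^a` is divided out, only the value at `1` of the other factor remains, which is the
convolution `sum_choose_mul_choose`. -/
theorem coeff_taylor_gramPoly {n a : ℕ} (h : a ≤ n) : (taylor 1 (gramPoly n a)).coeff a =
    (-1) ^ a * ((n + a + 1).choose (2 * a + 1) : ℝ) := by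
  have := coeff_mul_X_pow (taylor 1 (∑ l ∈ range (n - a + 1),
    C (((l + a).choose a * (n - l).choose a : ℕ) : ℝ) * X ^ l) * C ((-1) ^ a)) a 0
  rw [zero_add] at this
  rw [taylor_gramPoly, this, coeff_mul_C, taylor_coeff_zero, eval_finsetSum, mul_comm]
  congr 1
  rw [show n + a + 1 = n - a + 2 * a + 1 by omega, ← sum_choose_mul_choose]
  simp only [eval_mul, eval_C, eval_pow, eval_X, one_pow, mul_one]
  rw [← Nat.cast_sum]
  congr 1
  refine sum_congr rfl fun l hl => ?_
  rw [mem_range] at hl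
  rw [show n - a - l + a = n - l by omega]

theorem coeff_taylor_gramPoly_of_lt {n a j : ℕ} (hj : j < a) :
    (taylor 1 (gramPoly n a)).coeff j = 0 := by
  rw [taylor_gramPoly, coeff_mul_X_pow', if_neg (by omega)]

/-- Newton coefficients at `0` of the `a`-th difference of the kernel. As the kernel has degree
`2a`, they stop at `j = a`. -/
noncomputable def gramCoeff (n a j : ℕ) : ℝ := (fwdDiff (1 : ℝ))^[a + j] (gramKernel n a).eval 0

theorem gramCoeff_self (n a : ℕ) : gramCoeff n a a = (-1) ^ a * ((2 * a).choose a : ℝ) := by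
  have h := fwdDiff_iter_degree_eq_factorial (gramKernel n a)
  rw [natDegree_gramKernel, leadingCoeff_gramKernel] at h
  rw [gramCoeff, ← two_mul, h, Nat.cast_choose ℝ (show a ≤ 2 * a by omega),
    show 2 * a - a = a by omega]
  simp
  field_simp

theorem gramCoeff_of_lt {n a j : ℕ} (hj : a < j) : gramCoeff n a j = 0 := by
  rw [gramCoeff, fwdDiff_iter_eq_zero_of_degree_lt (by rw [natDegree_gramKernel]; omega)]
  rfl

theorem coeff_gramPoly_eq_sum {n a k : ℕ} (h : a ≤ n) (hk : k ≤ n) :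
    (gramPoly n a).coeff k = ∑ j ∈ range (a + 1), (k.choose j : ℝ) * gramCoeff n a j := by
  have h1 := shift_eq_sum_fwdDiff_iter (1 : ℝ) ((fwdDiff (1 : ℝ))^[a] (gramKernel n a).eval) k 0
  rw [zero_add, nsmul_one, ← coeff_gramPoly h hk] at h1
  -- Newton's expansion ends at `j = k`, but `C(k,j) = 0` beyond, so it may be extended to `k + a`
  -- and then cut at `a`.
  have h2 : ∀ N, k ≤ N → (gramPoly n a).coeff k =
      ∑ j ∈ range (N + 1), (k.choose j : ℝ) * gramCoeff n a j := by
    intro N hN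
    rw [h1]
    refine (sum_congr rfl fun j _ => ?_).trans (sum_subset (range_mono (by omega)) fun j _ hj => ?_)
    · rw [← Function.iterate_add_apply, nsmul_eq_mul, gramCoeff, add_comm a]
    · rw [mem_range] at hj
      simp [Nat.choose_eq_zero_of_lt (show k < j by omega)]
  rw [h2 (k + a) (by omega)]
  refine (sum_subset (range_mono (by omega)) fun j _ hj => ?_).symm
  rw [mem_range] at hj
  rw [gramCoeff_of_lt (by omega), mul_zero]

/-- Discrete Chebyshev (Gram) polynomials on `{0, …, n}`, in the binomial basis. -/
theorem exists_discreteChebyshev {n a : ℕ} (h : a ≤ n) :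
    ∃ c : ℕ → ℝ, c a = ((2 * a).choose a : ℝ) ∧
      (∀ j < a, ∑ k ∈ range (n + 1), (∑ i ∈ range (a + 1), (k.choose i : ℝ) * c i) *
        (k.choose j : ℝ) = 0) ∧
      ∑ k ∈ range (n + 1), (∑ i ∈ range (a + 1), (k.choose i : ℝ) * c i) * (k.choose a : ℝ) =
        ((n + a + 1).choose (2 * a + 1) : ℝ) := by
  -- The sign `(-1)^a` makes both the leading coefficient and the `a`-th moment positive.
  have e : ∀ j, ∑ k ∈ range (n + 1), (∑ i ∈ range (a + 1),
      (k.choose i : ℝ) * ((-1) ^ a * gramCoeff n a i)) * (k.choose j : ℝ) =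
      (-1) ^ a * (taylor 1 (gramPoly n a)).coeff j := by
    intro j
    rw [← sum_coeff_gramPoly_mul_choose h, mul_sum]
    refine sum_congr rfl fun k hk => ?_
    rw [mem_range] at hk
    rw [coeff_gramPoly_eq_sum h (by omega), ← mul_assoc, mul_sum]
    congr 1
    exact sum_congr rfl fun i _ => by ring
  have hs : ((-1 : ℝ) ^ a) * (-1) ^ a = 1 := by rw [← mul_pow]; simp
  refine ⟨fun i => (-1) ^ a * gramCoeff n a i, ?_, fun j hj => ?_, ?_⟩
  · simp only []
    rw [gramCoeff_self, ← mul_assoc, hs, one_mul]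
  · rw [e, coeff_taylor_gramPoly_of_lt hj, mul_zero]
  · rw [e, coeff_taylor_gramPoly h, ← mul_assoc, hs, one_mul]

end DiscreteChebyshev

/-! ### Sections, their coefficients and their sup norms. -/

theorem germ_eq_taylor (ζ : ℂ) (s : MvPolynomial (Fin 2) ℂ) :
    germ ζ s = Polynomial.taylor ζ (germ 0 s) := by
  have h : (MvPolynomial.aeval ![1, Polynomial.C ζ + Polynomial.X] :
      MvPolynomial (Fin 2) ℂ →ₐ[ℂ] Polynomial ℂ) =
      (Polynomial.taylorAlgHom ζ).comp
        (MvPolynomial.aeval ![1, Polynomial.C 0 + Polynomial.X]) := by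
    refine MvPolynomial.algHom_ext fun i => ?_
    fin_cases i
    · simp
    · simp only [Fin.mk_one, AlgHom.comp_apply, MvPolynomial.aeval_X, Matrix.cons_val_one,
        Polynomial.C_0, zero_add]
      exact (add_comm _ _).trans (Polynomial.taylor_X ζ).symm
  exact DFunLike.congr_fun h s

theorem natDegree_germ_zero_le {n : ℕ} {s : MvPolynomial (Fin 2) ℂ}
    (hs : s ∈ MvPolynomial.homogeneousSubmodule (Fin 2) ℂ n) : (germ 0 s).natDegree ≤ n := by
  have h : s.IsHomogeneous n := hs
  rw [germ, MvPolynomial.aeval_def, MvPolynomial.eval₂_eq']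
  refine Polynomial.natDegree_sum_le_of_forall_le _ _ fun d hd => ?_
  have hd' : d 0 + d 1 = n := by
    have := h (MvPolynomial.mem_support_iff.1 hd)
    rw [Finsupp.weight_apply, Finsupp.sum_fintype _ _ (by simp)] at this
    simpa [Fin.sum_univ_two] using this
  simp only [Fin.prod_univ_two, Matrix.cons_val_zero, Matrix.cons_val_one, one_pow, one_mul,
    Polynomial.C_0, zero_add, Polynomial.algebraMap_eq]
  exact (Polynomial.natDegree_C_mul_X_pow_le _ _).trans (by omega)

theorem natDegree_germ_le {n : ℕ} {s : MvPolynomial (Fin 2) ℂ}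
    (hs : s ∈ MvPolynomial.homogeneousSubmodule (Fin 2) ℂ n) (ζ : ℂ) :
    (germ ζ s).natDegree ≤ n := by
  rw [germ_eq_taylor, Polynomial.natDegree_taylor]
  exact natDegree_germ_zero_le hs

theorem norm_coeff_le_of_forall_sphere {p : Polynomial ℂ} {r B : ℝ} (hr : 0 < r)
    (h : ∀ z : ℂ, ‖z‖ = r → ‖p.eval z‖ ≤ B) (k : ℕ) : ‖p.coeff k‖ * r ^ k ≤ B := by
  have hd : DiffContOnCl ℂ (fun t => p.eval t) (Metric.ball 0 r) :=
    (Polynomial.differentiable _).diffContOnCl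
  have h3 := Complex.norm_iteratedDeriv_le_of_forall_mem_sphere_norm_le k hr hd
    (fun z hz => h z (by simpa using hz))
  have h4 : iteratedDeriv k (fun t => p.eval t) 0 = k.factorial * p.coeff k := by
    have h5 : ∀ (k : ℕ) (p : Polynomial ℂ), iteratedDeriv k (fun t => p.eval t) =
        fun t => (Polynomial.derivative^[k] p).eval t := by
      intro k
      induction k with
      | zero => intro p; simp
      | succ k ih =>
        intro p
        have h6 : deriv (fun t => p.eval t) = fun t => (Polynomial.derivative p).eval t :=
          funext fun t => Polynomial.deriv p
        rw [iteratedDeriv_succ', h6, ih, Function.iterate_succ_apply]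
    rw [h5]
    show Polynomial.eval 0 _ = _
    rw [← Polynomial.coeff_zero_eq_eval_zero, Polynomial.coeff_iterate_derivative]
    simp [Nat.descFactorial_self]
  rw [h4, norm_mul, Complex.norm_natCast, mul_div_assoc] at h3
  rw [← le_div_iff₀ (by positivity)]
  exact le_of_mul_le_mul_left h3 (by exact_mod_cast k.factorial_pos)

/-- On the circle `|z| = r` the weight `max(1, r⁻¹|z|)` equals `1`, so Cauchy's estimate applies
directly. -/
theorem norm_coeff_germ_zero_le {r : ℝ} (hr : 0 < r) {n : ℕ} {s : MvPolynomial (Fin 2) ℂ}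
    (hs : s ∈ MvPolynomial.homogeneousSubmodule (Fin 2) ℂ n) (k : ℕ) :
    ‖(germ 0 s).coeff k‖ * r ^ k ≤ supNorm r n s := by
  refine norm_coeff_le_of_forall_sphere hr (fun z hz => ?_) k
  have hv : (![1, z] : Fin 2 → ℂ) ≠ 0 := fun h0 => by simpa using congrFun h0 0
  have h1 := eval_eq_germ hs 0 ![1, z] (by simp)
  have h2 := le_ciSup (bddAbove_pointNorm hr hs) (Projectivization.mk ℂ _ hv)
  rw [pointNorm_mk hs] at h2
  simpa [h1, hz, hr.ne', supNorm] using h2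

/-- The section `∑ cₖ X₀ ^ (n - k) X₁ ^ k` of `𝒪(n)`. -/
noncomputable def sectionOfCoeffs (n : ℕ) (c : ℕ → ℂ) : MvPolynomial (Fin 2) ℂ :=
  ∑ k ∈ Finset.range (n + 1), MvPolynomial.C (c k) *
    (MvPolynomial.X 0 ^ (n - k) * MvPolynomial.X 1 ^ k)

theorem sectionOfCoeffs_mem (n : ℕ) (c : ℕ → ℂ) :
    sectionOfCoeffs n c ∈ MvPolynomial.homogeneousSubmodule (Fin 2) ℂ n := by
  refine Submodule.sum_mem _ fun k hk => ?_
  rw [Finset.mem_range] at hk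
  rw [MvPolynomial.mem_homogeneousSubmodule]
  have h := (MvPolynomial.isHomogeneous_C (Fin 2) (c k)).mul
    (((MvPolynomial.isHomogeneous_X ℂ (0 : Fin 2)).pow (n - k)).mul
      ((MvPolynomial.isHomogeneous_X ℂ (1 : Fin 2)).pow k))
  rwa [show 0 + (1 * (n - k) + 1 * k) = n by omega] at h

theorem germ_zero_sectionOfCoeffs (n : ℕ) (c : ℕ → ℂ) :
    germ 0 (sectionOfCoeffs n c) =
      ∑ k ∈ Finset.range (n + 1), Polynomial.C (c k) * Polynomial.X ^ k := by
  simp [germ, sectionOfCoeffs]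

theorem supNorm_sectionOfCoeffs_le {r : ℝ} (hr : 0 < r) (n : ℕ) (c : ℕ → ℂ) :
    supNorm r n (sectionOfCoeffs n c) ≤ ∑ k ∈ Finset.range (n + 1), ‖c k‖ * r ^ k := by
  refine Real.iSup_le (fun p => ?_) (by positivity)
  rw [pointNorm]
  set v := p.rep
  set M := max ‖v 0‖ (r⁻¹ * ‖v 1‖) with hM
  have hv0 : ‖v 0‖ ≤ M := le_max_left _ _
  have hM0 : 0 ≤ M := (norm_nonneg _).trans hv0
  have hv1 : ‖v 1‖ ≤ r * M := by
    rw [← inv_mul_le_iff₀ hr]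
    exact le_max_right _ _
  refine div_le_of_le_mul₀ (by positivity) (by positivity) ?_
  rw [sectionOfCoeffs, map_sum, Finset.sum_mul]
  refine (norm_sum_le _ _).trans (Finset.sum_le_sum fun k hk => ?_)
  rw [Finset.mem_range] at hk
  simp only [map_mul, MvPolynomial.eval_C, map_pow, MvPolynomial.eval_X, norm_mul, norm_pow]
  calc ‖c k‖ * (‖v 0‖ ^ (n - k) * ‖v 1‖ ^ k) ≤ ‖c k‖ * (M ^ (n - k) * (r * M) ^ k) := by gcongr
    _ = ‖c k‖ * r ^ k * (M ^ (n - k) * M ^ k) := by ring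
    _ = ‖c k‖ * r ^ k * M ^ n := by rw [← pow_add, Nat.sub_add_cancel (by omega)]

/-- Duality bound for the leading coefficient: testing against a function which is polynomial of
degree `a` on `{0, …, n}`. -/
theorem norm_lead_le {r : ℝ} (hr : 0 < r) {ζ : ℂ} (hζ : ‖ζ‖ = r) {n a : ℕ}
    {s : MvPolynomial (Fin 2) ℂ} (hs : s ∈ MvPolynomial.homogeneousSubmodule (Fin 2) ℂ n)
    (ha : ordAt ζ s = a) (c : ℕ → ℝ) :
    |c a| * r ^ a * ‖lead ζ s‖ ≤ supNorm r n s * ∑ k ∈ Finset.range (n + 1),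
      |∑ i ∈ Finset.range (a + 1), (k.choose i : ℝ) * c i| := by
  have hlead : lead ζ s = (germ ζ s).coeff a := by rw [← ha]; rfl
  have hsum := fun j => coeff_taylor_eq_sum (natDegree_germ_zero_le hs) ζ j
  simp only [← germ_eq_taylor] at hsum
  have key : (c a : ℂ) * (ζ ^ a * lead ζ s) = ∑ k ∈ Finset.range (n + 1),
      (germ 0 s).coeff k * ζ ^ k *
        ((∑ i ∈ Finset.range (a + 1), (k.choose i : ℝ) * c i : ℝ) : ℂ) := by
    -- Taylor coefficients below the order vanish, so only `c a` is seen.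
    have h1 : ∑ i ∈ Finset.range (a + 1), (c i : ℂ) * (ζ ^ i * (germ ζ s).coeff i) =
        (c a : ℂ) * (ζ ^ a * lead ζ s) := by
      rw [hlead]
      refine Finset.sum_eq_single_of_mem a (by simp) fun i hi hia => ?_
      rw [Finset.mem_range] at hi
      have : i < (germ ζ s).natTrailingDegree := by
        rw [show (germ ζ s).natTrailingDegree = a from ha]; omega
      rw [Polynomial.coeff_eq_zero_of_lt_natTrailingDegree this]
      simp
    rw [← h1]
    simp only [hsum, Finset.mul_sum]
    rw [Finset.sum_comm]
    refine Finset.sum_congr rfl fun k _ => ?_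
    rw [Complex.ofReal_sum, Finset.mul_sum]
    refine Finset.sum_congr rfl fun i _ => ?_
    push_cast
    ring
  have h2 := congrArg norm key
  rw [norm_mul, norm_mul, norm_pow, hζ, Complex.norm_real, Real.norm_eq_abs, ← mul_assoc] at h2
  rw [h2, Finset.mul_sum]
  refine (norm_sum_le _ _).trans (Finset.sum_le_sum fun k _ => ?_)
  rw [norm_mul, norm_mul, norm_pow, hζ, Complex.norm_real, Real.norm_eq_abs]
  exact mul_le_mul_of_nonneg_right (norm_coeff_germ_zero_le hr hs k) (abs_nonneg _)

/-- The coefficients `φ k · ζ^(-k)` turn moments of `φ` into Taylor coefficients at `[1 : ζ]`. -/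
theorem exists_section_of_moments {r : ℝ} (hr : 0 < r) {ζ : ℂ} (hζ : ‖ζ‖ = r) {n a : ℕ}
    (φ : ℕ → ℝ) (A : ℝ) (hA : 0 < A)
    (h0 : ∀ j < a, ∑ k ∈ Finset.range (n + 1), φ k * (k.choose j : ℝ) = 0)
    (h1 : ∑ k ∈ Finset.range (n + 1), φ k * (k.choose a : ℝ) = A) :
    ∃ s ∈ MvPolynomial.homogeneousSubmodule (Fin 2) ℂ n, s ≠ 0 ∧ ordAt ζ s = a ∧
      r ^ a * ‖lead ζ s‖ = A ∧ supNorm r n s ≤ ∑ k ∈ Finset.range (n + 1), |φ k| := by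
  have hζ0 : ζ ≠ 0 := fun h => by simp [h] at hζ; exact hr.ne hζ
  set c : ℕ → ℂ := fun k => φ k * (ζ ^ k)⁻¹ with hc
  have hs := sectionOfCoeffs_mem n c
  have hsum : ∀ j, ζ ^ j * (germ ζ (sectionOfCoeffs n c)).coeff j =
      ((∑ k ∈ Finset.range (n + 1), φ k * (k.choose j : ℝ) : ℝ) : ℂ) := by
    intro j
    rw [germ_eq_taylor, coeff_taylor_eq_sum (natDegree_germ_zero_le hs) ζ j, Complex.ofReal_sum]
    refine Finset.sum_congr rfl fun k hk => ?_
    have : (germ 0 (sectionOfCoeffs n c)).coeff k = c k := by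
      rw [germ_zero_sectionOfCoeffs, Polynomial.finsetSum_coeff]
      simp only [Polynomial.coeff_C_mul, Polynomial.coeff_X_pow, mul_ite, mul_one, mul_zero,
        Finset.sum_ite_eq, if_pos hk]
    rw [this, hc]
    push_cast
    field_simp
  have ha : (germ ζ (sectionOfCoeffs n c)).coeff a ≠ 0 := by
    intro h
    have := hsum a
    rw [h, h1, mul_zero] at this
    exact hA.ne (by exact_mod_cast this)
  have hord : (germ ζ (sectionOfCoeffs n c)).natTrailingDegree = a := by
    refine le_antisymm (Polynomial.natTrailingDegree_le_of_ne_zero ha) ?_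
    refine Polynomial.le_natTrailingDegree (fun h => ha (by simp [h])) fun j hj => ?_
    have := hsum j
    rw [h0 j hj, Complex.ofReal_zero] at this
    exact (mul_eq_zero.1 this).resolve_left (pow_ne_zero _ hζ0)
  refine ⟨sectionOfCoeffs n c, hs, fun h => ha (by simp [h, germ]), hord, ?_, ?_⟩
  · have h2 := congrArg norm (hsum a)
    rw [h1, norm_mul, norm_pow, hζ, Complex.norm_real, Real.norm_of_nonneg hA.le] at h2
    rw [lead, Polynomial.trailingCoeff, hord, h2]
  · refine (supNorm_sectionOfCoeffs_le hr n c).trans (le_of_eq ?_)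
    refine Finset.sum_congr rfl fun k _ => ?_
    rw [hc, norm_mul, norm_inv, norm_pow, hζ, Complex.norm_real, Real.norm_eq_abs]
    field_simp

theorem mem_ordSet_iff {ζ : ℂ} (hζ : ζ ≠ 0) {n a : ℕ} : a ∈ ordSet ζ n ↔ a ≤ n := by
  constructor
  · rintro ⟨s, hs, -, rfl⟩
    exact (Polynomial.natTrailingDegree_le_natDegree _).trans (natDegree_germ_le hs ζ)
  · intro h
    obtain ⟨c, -, h0, h1⟩ := exists_discreteChebyshev h
    obtain ⟨s, hs, hs0, ha, -⟩ := exists_section_of_moments (norm_pos_iff.2 hζ) rfl _ _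
      (by exact_mod_cast Nat.choose_pos (by omega)) h0 h1
    exact ⟨s, hs, hs0, ha⟩

/-! ### Two-sided estimate of `F_n(a)`. -/

/-- With `S = ∑ |φ k|`, `A` the `a`-th moment and `c a` the leading coefficient, `A / S ≤ r^a F_n(a)
≤ S / c a`. Inserting `S² ≤ (n+1) · c a · A` makes both sides `√(A / c a)` up to `√(n+1)`. -/
theorem abs_log_chebyshevSup_sub_le {r : ℝ} (hr : 0 < r) {ζ : ℂ} (hζ : ‖ζ‖ = r) {n a : ℕ}
    (h : a ≤ n) :
    |Real.log (chebyshevSup r ζ n a) - (1 / 2 * (Real.log ((n + a + 1).choose (2 * a + 1)) -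
      Real.log ((2 * a).choose a)) - a * Real.log r)| ≤ 1 / 2 * Real.log (n + 1) := by
  obtain ⟨c, hca, h0, h1⟩ := exists_discreteChebyshev h
  set φ : ℕ → ℝ := fun k => ∑ i ∈ Finset.range (a + 1), (k.choose i : ℝ) * c i with hφ
  set A : ℝ := ((n + a + 1).choose (2 * a + 1) : ℝ) with hAdef
  set S := ∑ k ∈ Finset.range (n + 1), |φ k| with hS
  have hA : 0 < A := by rw [hAdef]; exact_mod_cast Nat.choose_pos (by omega)
  have hc : 0 < c a := by rw [hca]; exact_mod_cast Nat.choose_pos (by omega)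
  rw [← hca]
  -- Expand one factor `φ` in the binomial basis; orthogonality leaves only the top term.
  have hsq : ∑ k ∈ Finset.range (n + 1), φ k ^ 2 = c a * A := by
    have e : ∀ k, φ k ^ 2 = ∑ i ∈ Finset.range (a + 1), c i * (φ k * (k.choose i : ℝ)) := by
      intro k
      rw [sq]
      nth_rewrite 2 [hφ]
      rw [Finset.mul_sum]
      exact Finset.sum_congr rfl fun i _ => by ring
    simp only [e]
    rw [Finset.sum_comm]
    simp only [← Finset.mul_sum]
    rw [Finset.sum_range_succ, h1, Finset.sum_eq_zero, zero_add]
    intro i hi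
    rw [h0 i (Finset.mem_range.1 hi), mul_zero]
  have hS2 : S ^ 2 ≤ (n + 1) * (c a * A) := by
    rw [← hsq]
    simpa using sq_sum_le_card_mul_sum_sq (s := Finset.range (n + 1)) (f := fun k => |φ k|)
  obtain ⟨s, hs, hs0, hord, hlead, hsup⟩ := exists_section_of_moments hr hζ φ A hA h0 h1
  have hsup0 := supNorm_pos hr hs hs0
  have hS0 : 0 < S := hsup0.trans_le hsup
  have hmem : ‖lead ζ s‖ / supNorm r n s ∈ quotients r ζ n a := ⟨s, hs, hs0, hord, rfl⟩
  have lower : A / (r ^ a * S) ≤ chebyshevSup r ζ n a := by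
    refine le_trans ?_ (le_csSup (bddAbove_quotients hr ζ n a) hmem)
    rw [← hlead, mul_div_mul_left _ _ (by positivity)]
    gcongr
  have upper : chebyshevSup r ζ n a ≤ S / (c a * r ^ a) := by
    refine csSup_le ⟨_, hmem⟩ ?_
    rintro _ ⟨s', hs', hs0', hord', rfl⟩
    have := norm_lead_le hr hζ hs' hord' c
    rw [abs_of_pos hc] at this
    rw [div_le_div_iff₀ (supNorm_pos hr hs' hs0') (by positivity)]
    linarith
  have hlow0 : 0 < A / (r ^ a * S) := by positivity
  have l1 := Real.log_le_log hlow0 lower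
  have l2 := Real.log_le_log (hlow0.trans_le lower) upper
  have l3 := Real.log_le_log (by positivity) hS2
  rw [Real.log_div hA.ne' (by positivity), Real.log_mul (by positivity) hS0.ne', Real.log_pow] at l1
  rw [Real.log_div hS0.ne' (by positivity), Real.log_mul hc.ne' (by positivity),
    Real.log_pow] at l2
  rw [Real.log_mul (by positivity) (by positivity), Real.log_mul hc.ne' hA.ne', Real.log_pow] at l3
  push_cast at l3
  rw [abs_le]
  constructor <;> linarith

/-! ### Stirling asymptotics. -/

/-- For `m ≥ 1` the Stirling sequence decreases from its first term, so the error is at most `1 +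
log √m ≤ √m`. The crude bound holds down to `m = 0`, hence applies even when `a_n` stays bounded. -/
theorem log_factorial_mem_Icc (m : ℕ) :
    Real.log m.factorial - (m * Real.log m - m) ∈ Set.Icc 0 (√(m : ℝ)) := by
  rcases m with _ | m
  · simp
  · have hm : (0 : ℝ) < ((m + 1 : ℕ) : ℝ) := by positivity
    have h1 := Stirling.le_log_factorial_stirling (Nat.succ_ne_zero m)
    have h2 : Real.log (Stirling.stirlingSeq (m + 1)) ≤ Real.log (Stirling.stirlingSeq 1) :=
      Stirling.log_stirlingSeq'_antitone (Nat.zero_le m)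
    rw [Stirling.log_stirlingSeq_formula, Stirling.stirlingSeq_one,
      Real.log_div (Real.exp_ne_zero 1) (by positivity), Real.log_sqrt (by norm_num),
      Real.log_mul (by norm_num) hm.ne', Real.log_div hm.ne' (Real.exp_ne_zero 1),
      Real.log_exp] at h2
    have h3 := Real.log_le_sub_one_of_pos (Real.sqrt_pos.2 hm)
    rw [Real.log_sqrt hm.le] at h3
    have h4 : 0 ≤ Real.log ((m + 1 : ℕ) : ℝ) := Real.log_natCast_nonneg _
    have h5 : 0 ≤ Real.log (2 * Real.pi) := Real.log_nonneg (by linarith [Real.pi_gt_three])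
    exact ⟨by linarith, by linarith⟩

theorem tendsto_log_factorial_div {m : ℕ → ℕ} {β : ℝ}
    (hm : Tendsto (fun n : ℕ => (m n : ℝ) / n) atTop (𝓝 β)) :
    Tendsto (fun n : ℕ => Real.log (m n).factorial / n - (m n : ℝ) / n * Real.log n) atTop
      (𝓝 (β * Real.log β - β)) := by
  have h1 : Tendsto (fun n : ℕ => √((m n : ℝ) / n) * √((n : ℝ)⁻¹)) atTop (𝓝 0) := by
    have h := (hm.sqrt).mul (tendsto_inv_atTop_nhds_zero_nat (𝕜 := ℝ)).sqrt
    simpa using h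
  have h2 : Tendsto (fun n : ℕ => (Real.log (m n).factorial -
      (m n * Real.log (m n) - m n)) / (n : ℝ)) atTop (𝓝 0) := by
    refine squeeze_zero (fun n => div_nonneg (log_factorial_mem_Icc _).1 n.cast_nonneg)
      (fun n => ?_) h1
    rcases n.eq_zero_or_pos with rfl | hn
    · simp
    · have hn' : (0 : ℝ) < n := by exact_mod_cast hn
      rw [← Real.sqrt_mul (by positivity), div_mul_eq_mul_div, ← div_eq_mul_inv, div_div,
        Real.sqrt_div (by positivity), Real.sqrt_mul_self hn'.le]
      exact div_le_div_of_nonneg_right (log_factorial_mem_Icc _).2 hn'.le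
  -- `x log x` is continuous at `0` too, which covers `β = 0`.
  have h3 := (((Real.continuous_mul_log.tendsto β).comp hm).sub hm).add h2
  rw [add_zero] at h3
  refine h3.congr' ((eventually_gt_atTop 0).mono fun n hn => ?_)
  have hn' : (n : ℝ) ≠ 0 := by exact_mod_cast hn.ne'
  simp only [Function.comp]
  rcases eq_or_ne (m n) 0 with h | h
  · simp [h]
  · rw [Real.log_div (by exact_mod_cast h) hn']
    field_simp
    ring

theorem log_choose {n k : ℕ} (h : k ≤ n) : Real.log (n.choose k) =
    Real.log n.factorial - Real.log k.factorial - Real.log (n - k).factorial := by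
  have h1 : ∀ m : ℕ, (m.factorial : ℝ) ≠ 0 := fun m => by exact_mod_cast m.factorial_ne_zero
  rw [Nat.cast_choose ℝ h, Real.log_div (h1 _) (mul_ne_zero (h1 _) (h1 _)),
    Real.log_mul (h1 _) (h1 _)]
  ring

theorem tendsto_log_chebyshevSup {r : ℝ} (hr : 0 < r) {ζ : ℂ} (hζ : ‖ζ‖ = r) {α : ℝ}
    (hα : α ∈ Set.Icc (0 : ℝ) 1) {a : ℕ → ℕ} (ha : ∀ n, 1 ≤ n → a n ≤ n)
    (hlim : Tendsto (fun n : ℕ => (a n : ℝ) / (n : ℝ)) atTop (𝓝 α)) :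
    Tendsto (fun n : ℕ => 1 / (n : ℝ) * Real.log (chebyshevSup r ζ n (a n))) atTop
      (𝓝 (-α * Real.log (4 * r) + 1 / 2 * (1 + α) * Real.log (1 + α)
            - 1 / 2 * (1 - α) * Real.log (1 - α) - α * Real.log α)) := by
  have hinv : Tendsto (fun n : ℕ => (1 : ℝ) / n) atTop (𝓝 0) := tendsto_one_div_atTop_nhds_zero_nat
  have t1 : Tendsto (fun n : ℕ => ((n + a n + 1 : ℕ) : ℝ) / n) atTop (𝓝 (1 + α)) := by
    have h := (hlim.const_add 1).add hinv
    rw [add_zero] at h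
    refine h.congr' ((eventually_gt_atTop 0).mono fun n hn => ?_)
    have hn' : (n : ℝ) ≠ 0 := by exact_mod_cast hn.ne'
    push_cast
    field_simp
  have t2 : Tendsto (fun n : ℕ => ((2 * a n : ℕ) : ℝ) / n) atTop (𝓝 (2 * α)) := by
    refine (hlim.const_mul 2).congr fun n => ?_
    push_cast
    ring
  have t3 : Tendsto (fun n : ℕ => ((2 * a n + 1 : ℕ) : ℝ) / n) atTop (𝓝 (2 * α)) := by
    have h := (hlim.const_mul 2).add hinv
    rw [add_zero] at h
    refine h.congr fun n => ?_
    push_cast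
    ring
  have t4 : Tendsto (fun n : ℕ => ((n - a n : ℕ) : ℝ) / n) atTop (𝓝 (1 - α)) := by
    refine (hlim.const_sub 1).congr' ((eventually_gt_atTop 0).mono fun n hn => ?_)
    have hn' : (n : ℝ) ≠ 0 := by exact_mod_cast hn.ne'
    simp only [Nat.cast_sub (ha n hn)]
    field_simp
  -- The `log n` terms cancel exactly, since `n+a+1 = (2a+1) + (n-a)` and `2a = a + a`.
  have main := (((((tendsto_log_factorial_div t1).sub (tendsto_log_factorial_div t3)).sub
    (tendsto_log_factorial_div t4)).sub (tendsto_log_factorial_div t2)).add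
    ((tendsto_log_factorial_div hlim).const_mul 2)).const_mul (1 / 2) |>.sub
    (hlim.mul_const (Real.log r))
  have hval : 1 / 2 * ((1 + α) * Real.log (1 + α) - (1 + α) -
      (2 * α * Real.log (2 * α) - 2 * α) - ((1 - α) * Real.log (1 - α) - (1 - α)) -
      (2 * α * Real.log (2 * α) - 2 * α) + 2 * (α * Real.log α - α)) - α * Real.log r =
      -α * Real.log (4 * r) + 1 / 2 * (1 + α) * Real.log (1 + α)
            - 1 / 2 * (1 - α) * Real.log (1 - α) - α * Real.log α := by
    rcases hα.1.eq_or_lt with rfl | h0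
    · simp
    · rw [Real.log_mul (by norm_num) h0.ne', Real.log_mul (by norm_num) hr.ne',
        show (4 : ℝ) = 2 ^ 2 by norm_num, Real.log_pow]
      push_cast
      ring
  rw [hval] at main
  have herr : Tendsto (fun n : ℕ => 1 / (n : ℝ) * Real.log (chebyshevSup r ζ n (a n)) -
      1 / (n : ℝ) * (1 / 2 * (Real.log ((n + a n + 1).choose (2 * a n + 1)) -
      Real.log ((2 * a n).choose (a n))) - a n * Real.log r)) atTop (𝓝 0) := by
    -- This is `log x / (x - 1) → 0` at `x = n + 1`.
    have hlog : Tendsto (fun n : ℕ => (1 / 2 : ℝ) * (Real.log ((n : ℝ) + 1) / n)) atTop (𝓝 0) := by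
      have h := (Real.tendsto_pow_log_div_mul_add_atTop 1 (-1) 1 one_ne_zero).comp
        (tendsto_natCast_atTop_atTop.comp (tendsto_add_atTop_nat 1))
      simpa [Function.comp_def] using h.const_mul (1 / 2 : ℝ)
    refine squeeze_zero_norm' ((eventually_gt_atTop 0).mono fun n hn => ?_) hlog
    rw [← mul_sub, norm_mul, Real.norm_of_nonneg (by positivity), Real.norm_eq_abs]
    calc _ ≤ 1 / (n : ℝ) * (1 / 2 * Real.log (n + 1)) := by
          gcongr
          exact abs_log_chebyshevSup_sub_le hr hζ (ha n hn)
      _ = _ := by ring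
  have hfin := herr.add main
  rw [zero_add] at hfin
  refine hfin.congr' ((eventually_gt_atTop 0).mono fun n hn => ?_)
  have hn' : (n : ℝ) ≠ 0 := by exact_mod_cast hn.ne'
  have han := ha n hn
  rw [log_choose (show 2 * a n + 1 ≤ n + a n + 1 by omega), log_choose (show a n ≤ 2 * a n by omega),
    show n + a n + 1 - (2 * a n + 1) = n - a n by omega, show 2 * a n - a n = a n by omega,
    Nat.cast_sub han]
  push_cast
  field_simp
  ring

/-! ### Okounkov body and conclusion. -/

theorem tendsto_floor_mul_div {α : ℝ} (hα : 0 ≤ α) :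
    Tendsto (fun n : ℕ => (⌊α * n⌋₊ : ℝ) / n) atTop (𝓝 α) :=
  (tendsto_nat_floor_mul_div_atTop hα).comp tendsto_natCast_atTop_atTop

theorem floor_mul_le {α : ℝ} (hα : α ≤ 1) (n : ℕ) : ⌊α * n⌋₊ ≤ n :=
  Nat.floor_le_of_le (mul_le_of_le_one_left n.cast_nonneg hα)

theorem okounkovBody_eq {ζ : ℂ} (hζ : ζ ≠ 0) : okounkovBody ζ = Set.Icc 0 1 := by
  refine Set.Subset.antisymm (closure_minimal ?_ isClosed_Icc) fun α hα => ?_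
  · simp only [Set.iUnion_subset_iff]
    rintro n hn _ ⟨a, ha, rfl⟩
    rw [mem_ordSet_iff hζ] at ha
    exact ⟨by positivity, div_le_one_of_le₀ (by exact_mod_cast ha) n.cast_nonneg⟩
  · refine mem_closure_of_tendsto (tendsto_floor_mul_div hα.1)
      ((eventually_ge_atTop 1).mono fun n hn => ?_)
    exact Set.mem_iUnion₂.2 ⟨n, hn, _, (mem_ordSet_iff hζ).2 (floor_mul_le hα.2 n), rfl⟩

end DiscChebyshev

theorem mainTheorem7 (r : ℝ) (hr : 0 < r) (ζ : ℂ) (hζ : ‖ζ‖ = r) :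
    DiscChebyshev.okounkovBody ζ = Set.Icc 0 1 ∧
      ∀ α ∈ Set.Icc (0 : ℝ) 1,
        DiscChebyshev.HasChebyshevTransformAt r ζ α
          (-α * Real.log (4 * r) + 1 / 2 * (1 + α) * Real.log (1 + α)
            - 1 / 2 * (1 - α) * Real.log (1 - α) - α * Real.log α) := by
  have hζ0 : ζ ≠ 0 := norm_pos_iff.1 (hζ ▸ hr)
  refine ⟨DiscChebyshev.okounkovBody_eq hζ0, fun α hα => ⟨⟨fun n => ⌊α * n⌋₊, fun n _ =>
    (DiscChebyshev.mem_ordSet_iff hζ0).2 (DiscChebyshev.floor_mul_le hα.2 n),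
    DiscChebyshev.tendsto_floor_mul_div hα.1⟩, fun a ha => ?_⟩⟩
  exact DiscChebyshev.tendsto_log_chebyshevSup hr hζ hα
    (fun n hn => (DiscChebyshev.mem_ordSet_iff hζ0).1 (ha.1 n hn)) ha.2
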